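/- All graphs are finite and simple. A labeling of a graph $G$ is a bijection $f$ from the edge set $E(G)$ to $\{1,2,\ldots,|E(G)|\}$; the sum at a vertex $v$ is $\sum_{e \ni v} f(e)$, the sum of the labels on the edges incident to $v$. The graph $G$ is antimagic if it has a labeling whose vertex sums are pairwise distinct. **Theorem.** Let $k \ge 8$ be an even integer. Every $k$-regular bipartite graph is antimagic. -/

import Mathlib

namespace SimpleGraph

section Antimagic

variable {V : Type*} [Fintype V] [DecidableEq V] (G : SimpleGraph V) [DecidableRel G.Adj]

/-- A labeling of `G`: a bijection from the edge set `E(G)` to `{1, ..., |E(G)|}`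
(the values of `f` outside of `E(G)` are irrelevant). -/
def IsEdgeLabeling (f : Sym2 V → ℕ) : Prop :=
  Set.BijOn f G.edgeSet (Set.Icc 1 G.edgeFinset.card)

/-- The sum at `v`: the sum of the labels on the edges incident to `v`. -/
def vertexSum (f : Sym2 V → ℕ) (v : V) : ℕ :=
  ∑ e ∈ G.incidenceFinset v, f e

/-- `G` is antimagic if it has a labeling whose vertex-sums are pairwise distinct. -/
def IsAntimagic : Prop :=
  ∃ f : Sym2 V → ℕ, G.IsEdgeLabeling f ∧ ∀ u v : V, u ≠ v → G.vertexSum f u ≠ G.vertexSum f v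

end Antimagic

end SimpleGraph

/-! Let A, B be the colour classes, n = |A| and k = 2(m + 4). The edges split into perfect matchings
indexed by a class r < m + 4 and one of two slots s. A label is m + 4 times a quotient below 2n,
plus a class, plus 1. Quotients are balanced so that the sum at a vertex of A is a constant plus 2(m
+ 4) times its rank. Ranking A by the rest of the sum at the partner in matching (0, false) makes
the sums on B strictly increasing in the rank too. All sums on A agree mod m + 4. Exchanging classes
2 and 3 at suitable vertices of A preserves this but shifts each sum on B by ±1 or ±2
(`Equiv.Perm.exists_increments_add_ne_zero`), which is nonzero mod m + 4 ≥ 4. So no sum on A equals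
one on B. -/

/-! ### Increments along two permutations -/

open Finset in
/-- A `ZMod 2`-valued function with zero sum on every cycle of `ρ` is a coboundary for `ρ`. -/
theorem Equiv.Perm.exists_eq_add_comp {β : Type*} [Fintype β] [DecidableEq β]
    (ρ : Equiv.Perm β) (z : β → ZMod 2)
    (hz : ∀ b, ∑ c with ρ.SameCycle b c, z c = 0) :
    ∃ x : β → ZMod 2, ∀ b, x b = z b + x (ρ b) := by
  classical
  let S := Equiv.Perm.SameCycle.setoid ρ
  let rep : β → β := fun b => (Quotient.mk S b).out
  have hrep : ∀ b, ρ.SameCycle b (rep b) := fun b => (Quotient.mk_out (s := S) b).symm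
  have hrepρ : ∀ b, rep (ρ b) = rep b := fun b => by
    have : Quotient.mk S (ρ b) = Quotient.mk S b :=
      Quotient.sound (Equiv.Perm.sameCycle_apply_left.2 (Equiv.Perm.SameCycle.refl ρ b))
    simp only [rep, this]
  have hex : ∀ b, ∃ i : ℕ, (ρ ^ i) b = rep b := fun b => by
    obtain ⟨i, -, hi⟩ := (hrep b).exists_pow_eq'
    exact ⟨i, hi⟩
  let N : β → ℕ := fun b => Nat.find (hex b)
  have hN : ∀ b, (ρ ^ N b) b = rep b := fun b => Nat.find_spec (hex b)
  have hNmin : ∀ b i, (ρ ^ i) b = rep b → N b ≤ i := fun b i h => Nat.find_min' (hex b) h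
  have hshift : ∀ (i : ℕ) b, (ρ ^ (i + 1)) b = (ρ ^ i) (ρ b) := fun i b => by
    rw [pow_succ, Equiv.Perm.mul_apply]
  -- Sum `z` from `b` up to the representative, excluded. Only at the representative does the
  -- recursion wrap around the whole cycle, and there `hz` applies.
  refine ⟨fun b => ∑ j ∈ range (N b), z ((ρ ^ j) b), fun b => ?_⟩
  have key : z b + ∑ j ∈ range (N (ρ b)), z ((ρ ^ j) (ρ b))
      = ∑ j ∈ range (N (ρ b) + 1), z ((ρ ^ j) b) := by
    rw [sum_range_succ', add_comm]
    simp [hshift]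
  have hN1 : (ρ ^ (N (ρ b) + 1)) b = rep b := by rw [hshift, hN, hrepρ]
  simp only
  rw [key]
  by_cases hb : rep b = b
  · have h0 : N b = 0 := Nat.le_zero.1 (hNmin b 0 (by simp [hb]))
    rw [h0, range_zero, sum_empty, ← hz b]
    have hinj : Set.InjOn (fun j : ℕ => (ρ ^ j) b) (range (N (ρ b) + 1)) := by
      have aux : ∀ i j : ℕ, i < j → j < N (ρ b) + 1 → (ρ ^ i) b ≠ (ρ ^ j) b := by
        intro i j hij hj h
        obtain ⟨d, rfl⟩ := Nat.exists_eq_add_of_lt hij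
        rw [add_assoc, pow_add, Equiv.Perm.mul_apply] at h
        have h2 := (ρ ^ i).injective h
        rw [hshift] at h2
        have := hNmin (ρ b) d (by rw [hrepρ, hb]; exact h2.symm)
        omega
      intro i hi j hj h
      simp only [coe_range, Set.mem_Iio] at hi hj
      rcases lt_trichotomy i j with hlt | heq | hlt
      · exact absurd h (aux i j hlt hj)
      · exact heq
      · exact absurd h.symm (aux j i hlt hi)
    rw [← sum_image (f := z) hinj]
    refine sum_congr ?_ fun _ _ => rfl
    ext c
    simp only [mem_filter, mem_univ, true_and, mem_image, mem_range]
    constructor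
    · intro hc
      obtain ⟨i, -, hi⟩ := hc.exists_pow_eq'
      refine ⟨i % (N (ρ b) + 1), Nat.mod_lt _ (Nat.succ_pos _), ?_⟩
      rw [hb] at hN1
      have hper : ∀ q : ℕ, (ρ ^ ((N (ρ b) + 1) * q)) b = b := by
        intro q
        rw [pow_mul]
        exact Equiv.Perm.pow_apply_eq_self_of_apply_eq_self hN1 q
      conv_rhs => rw [← hi, ← Nat.mod_add_div i (N (ρ b) + 1), pow_add, Equiv.Perm.mul_apply, hper]
    · rintro ⟨i, -, rfl⟩
      exact ⟨i, by simp⟩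
  · have : N b = N (ρ b) + 1 := by
      apply le_antisymm (hNmin _ _ hN1)
      rcases hNb : N b with _ | i
      · have := hN b
        rw [hNb] at this
        exact absurd this.symm (by simpa using hb)
      · have := hN b
        rw [hNb, hshift, ← hrepρ] at this
        exact Nat.succ_le_succ (hNmin _ _ this)
    rw [this]

open Finset in
/-- The cycles of two fixed-point-free permutations have a common system of distinct
representatives. -/
theorem Equiv.Perm.exists_distinct_cycle_representatives {β : Type*} [Fintype β]
    (ρ ρ' : Equiv.Perm β) (h : ∀ b, ρ b ≠ b) (h' : ∀ b, ρ' b ≠ b) :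
    ∃ g : Quotient (SameCycle.setoid ρ) ⊕ Quotient (SameCycle.setoid ρ') → β,
      Function.Injective g ∧ (∀ c, Quotient.mk _ (g (.inl c)) = c) ∧
        ∀ c, Quotient.mk _ (g (.inr c)) = c := by
  classical
  let q : β → Quotient (SameCycle.setoid ρ) := Quotient.mk _
  let q' : β → Quotient (SameCycle.setoid ρ') := Quotient.mk _
  let t : Quotient (SameCycle.setoid ρ) ⊕ Quotient (SameCycle.setoid ρ') → Finset β :=
    Sum.elim (fun c => univ.filter (q · = c)) (fun c => univ.filter (q' · = c))
  have hq : ∀ b, q (ρ b) = q b := fun b => Quotient.sound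
    (sameCycle_apply_left.2 (SameCycle.refl ρ b))
  have hq' : ∀ b, q' (ρ' b) = q' b := fun b => Quotient.sound
    (sameCycle_apply_left.2 (SameCycle.refl ρ' b))
  have htwo : ∀ i, 2 ≤ #(t i) := by
    rintro (c | c)
    · obtain ⟨b, rfl⟩ := Quotient.exists_rep c
      exact one_lt_card.2 ⟨ρ b, by simpa [t] using hq b, b, by simp [t, q], h b⟩
    · obtain ⟨b, rfl⟩ := Quotient.exists_rep c
      exact one_lt_card.2 ⟨ρ' b, by simpa [t] using hq' b, b, by simp [t, q'], h' b⟩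
  -- Hall's condition by double counting: a cycle has at least two points, and a point lies on only
  -- two cycles.
  have hall : ∀ s : Finset (Quotient (SameCycle.setoid ρ) ⊕ Quotient (SameCycle.setoid ρ')),
      #s ≤ #(s.biUnion t) := by
    intro s
    have := card_mul_le_card_mul (s := s) (t := s.biUnion t) (m := 2) (n := 2)
      (fun i b => b ∈ t i) (fun i hi => ?_) (fun b _ => ?_)
    · omega
    · refine (htwo i).trans (card_le_card fun b hb => ?_)
      exact (mem_bipartiteAbove _).2 ⟨mem_biUnion.2 ⟨i, hi, hb⟩, hb⟩
    · refine (card_le_card (t := {.inl (q b), .inr (q' b)}) fun i hi => ?_).trans card_le_two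
      have := ((mem_bipartiteBelow _).1 hi).2
      rcases i with c | c
      · have : q b = c := by simpa [t] using this
        simp [this]
      · have : q' b = c := by simpa [t] using this
        simp [this]
  obtain ⟨g, hg, hgt⟩ := (all_card_le_biUnion_card_iff_exists_injective t).1 hall
  exact ⟨g, hg, fun c => by simpa [t] using hgt (.inl c), fun c => by simpa [t] using hgt (.inr c)⟩

open Finset in
/-- For two fixed-point-free permutations there are `0/1`-valued functions whose increments along
the permutations never cancel. -/
theorem Equiv.Perm.exists_increments_add_ne_zero {β : Type*} [Fintype β]
    (ρ ρ' : Equiv.Perm β) (h : ∀ b, ρ b ≠ b) (h' : ∀ b, ρ' b ≠ b) :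
    ∃ x y : β → ZMod 2, ∀ b,
      (((x b).val : ℤ) - (x (ρ b)).val) + (((y b).val : ℤ) - (y (ρ' b)).val) ≠ 0 := by
  classical
  obtain ⟨g, hg, hgl, hgr⟩ := exists_distinct_cycle_representatives ρ ρ' h h'
  let q : β → Quotient (SameCycle.setoid ρ) := Quotient.mk _
  let q' : β → Quotient (SameCycle.setoid ρ') := Quotient.mk _
  have hqq : ∀ b c, ρ.SameCycle b c ↔ q c = q b := fun b c =>
    ⟨fun hc => Quotient.sound hc.symm, fun hc => (Quotient.exact hc).symm⟩
  have hqq' : ∀ b c, ρ'.SameCycle b c ↔ q' c = q' b := fun b c =>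
    ⟨fun hc => Quotient.sound hc.symm, fun hc => (Quotient.exact hc).symm⟩
  have hq' : ∀ b, q' (ρ' b) = q' b := fun b => Quotient.sound
    (sameCycle_apply_left.2 (SameCycle.refl ρ' b))
  let r : β → β := fun b => g (.inl (q b))
  let r' : β → β := fun b => g (.inr (q' b))
  have hr : ∀ b c, q b = q c → r b = r c := fun b c hbc => by simp only [r, hbc]
  have hr' : ∀ b c, q' b = q' c → r' b = r' c := fun b c hbc => by simp only [r', hbc]
  have hqr : ∀ b, q (r b) = q b := fun b => hgl (q b)
  have hqr' : ∀ b, q' (r' b) = q' b := fun b => hgr (q' b)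
  have hrr' : ∀ b c, r b ≠ r' c := fun b c hbc => by simpa using hg hbc
  let e : β → ZMod 2 := fun b => ∑ c with q c = q b, 1
  have he : ∀ b c, q b = q c → e b = e c := fun b c hbc => by simp only [e, hbc]
  -- `d` is supported on the representatives of the odd cycles of `ρ`
  let d : β → ZMod 2 := fun b => if b = r b then e b else 0
  -- `x` alternates along each cycle, stalling once, at the representative, if the length is odd.
  obtain ⟨x, hx⟩ := ρ.exists_eq_add_comp (fun b => 1 + d b) (fun b => by
    simp only [hqq, sum_add_distrib]
    have : ∑ c with q c = q b, d c = e b := by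
      rw [sum_eq_single (r b)]
      · simp only [d]
        rw [if_pos (hr _ _ (hqr b).symm), he _ _ (hqr b)]
      · intro c hc hne
        simp only [mem_filter, mem_univ, true_and] at hc
        exact if_neg (by rwa [hr _ _ hc])
      · intro hc
        simp [hqr] at hc
    rw [this]
    exact CharTwo.add_self_eq_zero _)
  let e' : β → ZMod 2 := fun b => ∑ c with q' c = q' b, d c
  have he' : ∀ b c, q' b = q' c → e' b = e' c := fun b c hbc => by simp only [e', hbc]
  let d' : β → ZMod 2 := fun b => if b = r' b then e' b else 0
  -- `y` changes exactly where `x` stalls, except that `d'` may force one more change per cycle of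
  -- `ρ'` to fix parity.
  obtain ⟨y, hy⟩ := ρ'.exists_eq_add_comp (fun b => d b + d' b) (fun b => by
    simp only [hqq', sum_add_distrib]
    have : ∑ c with q' c = q' b, d' c = e' b := by
      rw [sum_eq_single (r' b)]
      · simp only [d']
        rw [if_pos (hr' _ _ (hqr' b).symm), he' _ _ (hqr' b)]
      · intro c hc hne
        simp only [mem_filter, mem_univ, true_and] at hc
        exact if_neg (by rwa [hr' _ _ hc])
      · intro hc
        simp [hqr'] at hc
    rw [this]
    exact CharTwo.add_self_eq_zero _)
  -- Flipping `y` on whole cycles of `ρ'` makes it agree with `x` at `r' b`. If both change there,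
  -- the increments have equal sign.
  refine ⟨x, fun b => y b + (y (r' b) + x (r' b)), fun b => ?_⟩
  have hfin : ∀ x₀ x₁ y₀ y₁ s t : ZMod 2, x₀ = 1 + s + x₁ → y₀ = s + t + y₁ →
      (t ≠ 0 → s = 0 ∧ y₀ = x₀) →
      ((x₀.val : ℤ) - x₁.val) + ((y₀.val : ℤ) - y₁.val) ≠ 0 := by decide
  refine hfin _ _ _ _ (d b) (d' b) (hx b) ?_ fun ht => ?_
  · simp only
    rw [hy b, hr' _ _ (hq' b)]
    ring
  · have hb : b = r' b := by
      by_contra hne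
      exact ht (if_neg hne)
    refine ⟨if_neg fun hb' => hrr' b b (hb'.symm.trans hb), ?_⟩
    simp only
    rw [← hb, ← add_assoc, CharTwo.add_self_eq_zero, zero_add]

/-! ### Decomposition into bijections -/

open Finset in
/-- A biregular relation of degree `card ι` is a disjoint union of `card ι` bijections. -/
theorem exists_equivs_of_biregular {α β : Type*} [Fintype α] [Fintype β] [DecidableEq α]
    [DecidableEq β] (d : ℕ) (N : α → Finset β) (hα : ∀ a, #(N a) = d)
    (hβ : ∀ b, #{a | b ∈ N a} = d) (hcard : Fintype.card α = Fintype.card β) :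
    ∃ π : Fin d → α ≃ β, (∀ a b, b ∈ N a ↔ ∃ j, π j a = b) ∧
      ∀ a, Function.Injective fun j => π j a := by
  suffices ∃ π : Fin d → α ≃ β, ∀ a b, b ∈ N a ↔ ∃ j, π j a = b by
    obtain ⟨π, hπ⟩ := this
    refine ⟨π, hπ, fun a => ?_⟩
    have : N a = univ.image fun j => π j a := by
      ext b
      simp [hπ]
    have hinj := card_image_iff.1 (show #(univ.image fun j => π j a) = #univ by
      rw [← this, hα, card_univ, Fintype.card_fin])
    exact fun i j hij => hinj (by simp) (by simp) hij
  induction d generalizing N with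
  | zero => exact ⟨Fin.elim0, fun a b => by simp [card_eq_zero.1 (hα a)]⟩
  | succ d ih =>
    -- Regularity gives Hall's condition; one bijection is removed and the rest is inductive.
    have hall : ∀ s : Finset α, #s ≤ #(s.biUnion N) := by
      intro s
      have := card_mul_le_card_mul (s := s) (t := s.biUnion N) (m := d + 1) (n := d + 1)
        (fun a b => b ∈ N a) (fun a ha => ?_) (fun b _ => ?_)
      · exact Nat.le_of_mul_le_mul_right this (Nat.succ_pos d)
      · rw [← hα a]
        exact card_le_card fun b hb =>
          (mem_bipartiteAbove _).2 ⟨mem_biUnion.2 ⟨a, ha, hb⟩, hb⟩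
      · rw [← hβ b]
        exact card_le_card fun a ha => by simpa using ((mem_bipartiteBelow _).1 ha).2
    obtain ⟨f, hf, hfN⟩ := (all_card_le_biUnion_card_iff_exists_injective N).1 hall
    let e : α ≃ β := Equiv.ofBijective f ((Fintype.bijective_iff_injective_and_card f).2 ⟨hf, hcard⟩)
    have heN : ∀ a, e a ∈ N a := hfN
    obtain ⟨π, hπ⟩ := ih (fun a => (N a).erase (e a))
      (fun a => by rw [card_erase_of_mem (heN a), hα a, Nat.add_sub_cancel])
      (fun b => by
        have : ({a | b ∈ (N a).erase (e a)} : Finset α)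
            = ({a | b ∈ N a} : Finset α).erase (e.symm b) := by
          ext a
          simp [Equiv.eq_symm_apply, eq_comm]
        rw [this, card_erase_of_mem (by simpa using heN (e.symm b)), hβ b, Nat.add_sub_cancel])
    refine ⟨Fin.cons e π, fun a b => ?_⟩
    rw [Fin.exists_fin_succ]
    simp only [Fin.cons_zero, Fin.cons_succ, ← hπ, mem_erase]
    constructor
    · intro hb
      by_cases hab : e a = b
      · exact .inl hab
      · exact .inr ⟨fun h => hab h.symm, hb⟩
    · rintro (rfl | h)
      · exact heN a
      · exact h.2

/-! ### Construction of the labels -/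

/-- The quotient part of a label in residue class `r` and slot `s`, at the vertex with
position `i`. -/
def labelQuotient (n i : ℕ) : ℕ → Bool → ℕ
  -- With 2t added to the first entry, the two slots of a class fill 0, ..., 2n - 1: evens and odds
  -- in class 0, two halves otherwise. The coefficients of i in classes 0 to 3 are -2, 2, 2, -2;
  -- later classes cancel internally.
  | 0, false => 0
  | 0, true => 2 * (n - 1 - i) + 1
  | 1, false => i
  | 1, true => n + i
  | 2, false => i
  | 2, true => n + i
  | 3, false => 2 * n - 1 - i
  | 3, true => n - 1 - i
  | _, false => i
  | _, true => 2 * n - 1 - i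

/-- The part of the quotient of a label which depends on the rank `t` of the vertex. -/
def rankQuotient (t r : ℕ) (s : Bool) : ℕ := if r = 0 ∧ s = false then 2 * t else 0

theorem labelQuotient_add_rankQuotient_lt {n i t : ℕ} (hi : i < n) (ht : t < n) (r : ℕ)
    (s : Bool) : labelQuotient n i r s + rankQuotient t r s < 2 * n := by
  rcases r with _ | _ | _ | _ | r <;> cases s <;> simp [labelQuotient, rankQuotient] <;> omega

theorem eq_of_labelQuotient_add_rankQuotient_eq {n i t i' t' r : ℕ} {s s' : Bool} (hi : i < n)
    (ht : t < n) (hi' : i' < n) (htt : t = t' → i = i')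
    (h : labelQuotient n i r s + rankQuotient t r s
      = labelQuotient n i' r s' + rankQuotient t' r s') : i = i' ∧ s = s' := by
  rcases r with _ | _ | _ | _ | r <;> cases s <;> cases s' <;>
    simp [labelQuotient, rankQuotient] at h ⊢ <;> omega

open Finset in
theorem sum_labelQuotient {n i : ℕ} (hi : i < n) (m : ℕ) :
    ∑ r : Fin (m + 4), (labelQuotient n i r true + labelQuotient n i r false)
      = 7 * n - 3 + m * (2 * n - 1) := by
  rw [Fin.sum_univ_succ, Fin.sum_univ_succ, Fin.sum_univ_succ, Fin.sum_univ_succ]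
  have : ∀ r : Fin m, labelQuotient n i r.succ.succ.succ.succ true
      + labelQuotient n i r.succ.succ.succ.succ false = 2 * n - 1 := fun r => by
    simp only [Fin.val_succ, labelQuotient]
    omega
  simp only [this, sum_const, card_univ, Fintype.card_fin, smul_eq_mul]
  simp only [Fin.val_succ, Fin.val_zero, zero_add, Nat.reduceAdd, labelQuotient]
  omega

/-- Any function on a finite type can be sorted. -/
theorem exists_equiv_fin_monotone {α : Type*} [Fintype α] (q : α → ℕ) :
    ∃ t : α ≃ Fin (Fintype.card α), ∀ a a', t a < t a' → q a ≤ q a' := by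
  let e := Fintype.equivFin α
  refine ⟨e.trans (Tuple.sort (q ∘ e.symm)).symm, fun a a' h => ?_⟩
  simpa using Tuple.monotone_sort (q ∘ e.symm) h.le

section

variable {α β : Type*} [Fintype α] (m : ℕ)

/-- The class permutation at a vertex: classes `2` and `3` are exchanged where `x = 0`. -/
def classPerm (x : ZMod 2) : Equiv.Perm (Fin (m + 4)) := if x = 0 then Equiv.swap 2 3 else 1

/-- Since class 0 is never exchanged, the rank term stays in the matching (0, false). -/
theorem classPerm_eq_zero_iff (x : ZMod 2) (r : Fin (m + 4)) :
    ((classPerm m x r : Fin (m + 4)) : ℕ) = 0 ↔ r = 0 := by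
  have h2 : (0 : Fin (m + 4)) ≠ 2 := fun h => absurd (congrArg Fin.val h) (Nat.zero_ne_add_one 1)
  have h3 : (0 : Fin (m + 4)) ≠ 3 := fun h => absurd (congrArg Fin.val h) (Nat.zero_ne_add_one 2)
  have : classPerm m x 0 = 0 := by
    unfold classPerm
    split_ifs
    · exact Equiv.swap_apply_of_ne_of_ne h2 h3
    · rfl
  rw [← (classPerm m x).injective.eq_iff (a := r), this, Fin.ext_iff, Fin.val_zero]

theorem classPerm_val (x : ZMod 2) (r : Fin (m + 4)) :
    (((classPerm m x r : Fin (m + 4)) : ℕ) : ℤ)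
      = r + ((if r = 2 then 1 - (x.val : ℤ) else 0) - if r = 3 then 1 - (x.val : ℤ) else 0) := by
  have h2 : ((2 : Fin (m + 4)) : ℕ) = 2 := rfl
  have h3 : ((3 : Fin (m + 4)) : ℕ) = 3 := rfl
  have h23 : (2 : Fin (m + 4)) ≠ 3 := fun h => by
    have := congrArg Fin.val h
    rw [h2, h3] at this
    omega
  unfold classPerm
  have hx : x = 0 ∨ x = 1 := by revert x; decide
  rcases hx with rfl | rfl
  · rw [if_pos rfl, Equiv.swap_apply_def]
    split_ifs with h h' h'
    · exact absurd (h.symm.trans h') h23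
    · rw [h, h2, h3, ZMod.val_zero]; rfl
    · rw [h', h2, h3, ZMod.val_zero]; rfl
    · simp
  · simp [ZMod.val_one]

/-- The label of the edge at `a` in the matching `(r, s)`, before ranks are taken into account. -/
def baseLabel (φ : Bool → α → ZMod 2) (i : α → ℕ) (a : α) (j : Fin (m + 4) × Bool) : ℕ :=
  (m + 4) * labelQuotient (Fintype.card α) (i a) (classPerm m (φ j.2 a) j.1) j.2
    + (classPerm m (φ j.2 a) j.1 + 1)

/-- The label of the edge at `a` in the matching `(r, s)`. -/
def matchingLabel (φ : Bool → α → ZMod 2) (i t : α → ℕ) (a : α) (j : Fin (m + 4) × Bool) : ℕ :=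
  baseLabel m φ i a j + if j = (0, false) then (m + 4) * (2 * t a) else 0

variable {m}

theorem matchingLabel_eq (φ : Bool → α → ZMod 2) (i t : α → ℕ) (a : α)
    (j : Fin (m + 4) × Bool) :
    matchingLabel m φ i t a j
      = (m + 4) * (labelQuotient (Fintype.card α) (i a) (classPerm m (φ j.2 a) j.1) j.2
          + rankQuotient (t a) (classPerm m (φ j.2 a) j.1) j.2)
        + (classPerm m (φ j.2 a) j.1 + 1) := by
  obtain ⟨r, s⟩ := j
  simp only [matchingLabel, baseLabel, rankQuotient, classPerm_eq_zero_iff, Prod.mk.injEq]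
  split_ifs <;> ring

/-- The residue of the label minus 1 gives the class, the quotient then gives vertex and slot, and
undoing the class permutation gives r. -/
theorem matchingLabel_injective (φ : Bool → α → ZMod 2) (i t : α ≃ Fin (Fintype.card α)) :
    Function.Injective fun p : α × (Fin (m + 4) × Bool) =>
      matchingLabel m φ (fun a => i a) (fun a => t a) p.1 p.2 := by
  rintro ⟨a, r, s⟩ ⟨a', r', s'⟩ h
  simp only [matchingLabel_eq] at h
  have hmod := congrArg (fun x => (x - 1) % (m + 4)) h
  have hdiv := congrArg (fun x => (x - 1) / (m + 4)) h
  simp only [← add_assoc, Nat.add_sub_cancel, Nat.mul_add_mod, Nat.mod_eq_of_lt (Fin.is_lt _)]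
    at hmod
  simp only [← add_assoc, Nat.add_sub_cancel, Nat.mul_add_div (Nat.succ_pos (m + 3)),
    Nat.div_eq_of_lt (Fin.is_lt _), add_zero] at hdiv
  rw [hmod] at hdiv
  obtain ⟨hi, rfl⟩ := eq_of_labelQuotient_add_rankQuotient_eq (i a).2 (t a).2 (i a').2
    (fun h => by rw [t.injective (Fin.ext h)]) hdiv
  obtain rfl := i.injective (Fin.ext hi)
  obtain rfl := (classPerm m (φ s a)).injective (Fin.ext hmod)
  rfl

theorem matchingLabel_mem_Icc (φ : Bool → α → ZMod 2) (i t : α ≃ Fin (Fintype.card α)) (a : α)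
    (j : Fin (m + 4) × Bool) :
    matchingLabel m φ (fun a => i a) (fun a => t a) a j
      ∈ Finset.Icc 1 ((m + 4) * (2 * Fintype.card α)) := by
  rw [matchingLabel_eq, Finset.mem_Icc]
  have h := labelQuotient_add_rankQuotient_lt (i a).2 (t a).2 (classPerm m (φ j.2 a) j.1) j.2
  have h' := (classPerm m (φ j.2 a) j.1).2
  refine ⟨by omega, ?_⟩
  calc _ ≤ (m + 4) * (labelQuotient (Fintype.card α) (i a) (classPerm m (φ j.2 a) j.1) j.2
          + rankQuotient (t a) (classPerm m (φ j.2 a) j.1) j.2 + 1) := by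
        rw [mul_add_one]; omega
    _ ≤ _ := Nat.mul_le_mul_left _ h

/-! ### Vertex sums -/

open Finset

/-- Exchanging classes at `a` only reorders the summands of a slot. -/
theorem sum_baseLabel (φ : Bool → α → ZMod 2) (i : α ≃ Fin (Fintype.card α)) (a : α) :
    ∑ j, baseLabel m φ (fun a => i a) a j
      = (m + 4) * (7 * Fintype.card α - 3 + m * (2 * Fintype.card α - 1))
        + ∑ j : Fin (m + 4) × Bool, ((j.1 : ℕ) + 1) := by
  rw [← sum_labelQuotient (i a).2 m, Fintype.sum_prod_type_right, Fintype.sum_prod_type_right]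
  simp only [baseLabel]
  have (s : Bool) := Equiv.sum_comp (classPerm m (φ s a)) fun r =>
    (m + 4) * labelQuotient (Fintype.card α) (i a) r s + ((r : ℕ) + 1)
  simp only [this, Fintype.sum_bool, sum_add_distrib, mul_add, mul_sum]

theorem sum_matchingLabel (φ : Bool → α → ZMod 2) (i t : α → ℕ)
    (v : Fin (m + 4) × Bool → α) :
    ∑ j, matchingLabel m φ i t (v j) j
      = ∑ j, baseLabel m φ i (v j) j + (m + 4) * (2 * t (v (0, false))) := by
  simp [matchingLabel, sum_add_distrib]

/-- Constant `v` gives a sum on A, where the correction vanishes; `v j = (π j).symm b` gives the sum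
at `b`. -/
theorem sum_matchingLabel_modEq (φ : Bool → α → ZMod 2) (i t : α → ℕ)
    (v : Fin (m + 4) × Bool → α) :
    ((∑ j, matchingLabel m φ i t (v j) j : ℕ) : ℤ) ≡
      ∑ j : Fin (m + 4) × Bool, ((j.1 : ℤ) + 1)
        - ((((φ true (v (2, true))).val : ℤ) - (φ true (v (3, true))).val)
        + (((φ false (v (2, false))).val : ℤ) - (φ false (v (3, false))).val))
        [ZMOD ((m + 4 : ℕ) : ℤ)] := by
  have h : ∑ j : Fin (m + 4) × Bool, (((classPerm m (φ j.2 (v j)) j.1 : ℕ) : ℤ) + 1)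
      = ∑ j : Fin (m + 4) × Bool, ((j.1 : ℤ) + 1)
        - ((((φ true (v (2, true))).val : ℤ) - (φ true (v (3, true))).val)
        + (((φ false (v (2, false))).val : ℤ) - (φ false (v (3, false))).val)) := by
    simp only [classPerm_val, sum_add_distrib, Fintype.sum_prod_type_right, Fintype.sum_bool,
      sum_sub_distrib, sum_ite_eq', mem_univ, if_true]
    ring
  rw [← h, Int.modEq_iff_dvd]
  simp only [matchingLabel_eq, Nat.cast_sum, ← sum_sub_distrib]
  refine dvd_sum fun j _ => ?_
  rw [← dvd_neg, neg_sub]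
  push_cast
  rw [add_sub_cancel_right]
  exact dvd_mul_right _ _

end

open Finset in
/-- Labelling of an edge set that is a disjoint union of an even number, at least `8`, of perfect
matchings. -/
theorem exists_matching_labeling {α β : Type*} [Fintype α] [Fintype β] (m : ℕ)
    (π : Fin (m + 4) × Bool → α ≃ β) (hπ : ∀ a, Function.Injective fun j => π j a) :
    ∃ f : α → Fin (m + 4) × Bool → ℕ,
      (Function.Injective fun p : α × (Fin (m + 4) × Bool) => f p.1 p.2) ∧
      (∀ a j, f a j ∈ Icc 1 ((m + 4) * (2 * Fintype.card α))) ∧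
      (Function.Injective fun a => ∑ j, f a j) ∧
      (Function.Injective fun b => ∑ j, f ((π j).symm b) j) ∧
      ∀ a b, ∑ j, f a j ≠ ∑ j, f ((π j).symm b) j := by
  have hne : ∀ s b, π (2, s) ((π (3, s)).symm b) ≠ b := fun s b h => by
    have h1 : π (2, s) ((π (3, s)).symm b) = π (3, s) ((π (3, s)).symm b) := by simpa using h
    have h2 := congrArg (fun j : Fin (m + 4) × Bool => j.1.val) (hπ _ h1)
    exact absurd h2 (by change ¬ (2 = 3); decide)
  obtain ⟨x, y, hxy⟩ := Equiv.Perm.exists_increments_add_ne_zero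
    ((π (3, true)).symm.trans (π (2, true))) ((π (3, false)).symm.trans (π (2, false)))
    (hne true) (hne false)
  -- Read through the (2, s)-partner, the correction at `b` becomes the increments of `x` and `y` at
  -- `b`.
  let φ : Bool → α → ZMod 2 := fun s a => if s then x (π (2, true) a) else y (π (2, false) a)
  let i := Fintype.equivFin α
  let q : β → ℕ := fun b => ∑ j, baseLabel m φ (fun a => i a) ((π j).symm b) j
  -- Not circular: `q` does not involve ranks.
  obtain ⟨t, ht⟩ := exists_equiv_fin_monotone fun a => q (π (0, false) a)
  have hB : ∀ b, ∑ j, matchingLabel m φ (fun a => i a) (fun a => t a) ((π j).symm b) j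
      = q b + (m + 4) * (2 * (t ((π (0, false)).symm b) : ℕ)) := fun b =>
    sum_matchingLabel φ _ _ fun j => (π j).symm b
  have hlt : ∀ b b', t ((π (0, false)).symm b) < t ((π (0, false)).symm b') →
      q b + (m + 4) * (2 * (t ((π (0, false)).symm b) : ℕ))
        < q b' + (m + 4) * (2 * (t ((π (0, false)).symm b') : ℕ)) := fun b b' h => by
    have h1 := ht _ _ h
    simp only [Equiv.apply_symm_apply] at h1
    exact add_lt_add_of_le_of_lt h1 (Nat.mul_lt_mul_of_pos_left (by omega) (by omega))
  refine ⟨matchingLabel m φ (fun a => i a) (fun a => t a), matchingLabel_injective φ i t,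
    matchingLabel_mem_Icc φ i t, fun a a' h => ?_, fun b b' h => ?_, fun a b h => ?_⟩
  · have hA := fun a => sum_matchingLabel φ (fun a => (i a : ℕ)) (fun a => (t a : ℕ))
      fun _ : Fin (m + 4) × Bool => a
    simp only [hA, sum_baseLabel] at h
    have := Nat.eq_of_mul_eq_mul_left (by omega) (Nat.add_left_cancel h)
    exact t.injective (Fin.ext (by omega))
  · simp only [hB] at h
    rcases lt_trichotomy (t ((π (0, false)).symm b)) (t ((π (0, false)).symm b')) with h1 | h1 | h1
    · exact absurd h (hlt _ _ h1).ne
    · exact (π (0, false)).symm.injective (t.injective h1)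
    · exact absurd h (hlt _ _ h1).ne'
  · have h1 := sum_matchingLabel_modEq φ (fun a => (i a : ℕ)) (fun a => (t a : ℕ))
      fun j => (π j).symm b
    have h2 := sum_matchingLabel_modEq φ (fun a => (i a : ℕ)) (fun a => (t a : ℕ))
      fun _ : Fin (m + 4) × Bool => a
    rw [← h] at h1
    have h4 := (h2.symm.trans h1).dvd
    simp only [sub_self, add_zero, sub_zero, sub_sub_cancel_left, dvd_neg] at h4
    have h3 := hxy b
    simp only [Equiv.trans_apply] at h3
    simp only [φ, Equiv.apply_symm_apply, if_true, Bool.false_eq_true, if_false] at h4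
    have hv : ∀ z : ZMod 2, ((z.val : ℕ) : ℤ) ≤ 1 := by decide
    have b1 := hv (x b)
    have b2 := hv (x (π (2, true) ((π (3, true)).symm b)))
    have b3 := hv (y b)
    have b4 := hv (y (π (2, false) ((π (3, false)).symm b)))
    -- The correction is at most 2 in absolute value, below m + 4.
    refine h3 (Int.eq_zero_of_abs_lt_dvd h4 ?_)
    rw [abs_lt]
    push_cast
    constructor <;> omega

/-! ### Transfer to graphs -/

open Finset in
/-- A parametrization of the edges turns vertex sums into sums over the parameters. -/
theorem SimpleGraph.vertexSum_extend {V : Type*} [Fintype V] [DecidableEq V] (G : SimpleGraph V)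
    [DecidableRel G.Adj] {ι J : Type*} [Fintype J] {E : ι → Sym2 V} (hE : Function.Injective E)
    (hr : Set.range E = G.edgeSet) (f : ι → ℕ) (v : V) (g : J → ι) (hg : Function.Injective g)
    (h : ∀ p, v ∈ E p ↔ ∃ j, g j = p) :
    G.vertexSum (Function.extend E f 0) v = ∑ j, f (g j) := by
  have : G.incidenceFinset v = univ.image fun j => E (g j) := by
    ext e
    rw [mem_incidenceFinset, mem_image, incidenceSet, Set.mem_sep_iff, ← hr]
    constructor
    · rintro ⟨⟨p, rfl⟩, hv⟩
      obtain ⟨j, rfl⟩ := (h p).1 hv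
      exact ⟨j, mem_univ _, rfl⟩
    · rintro ⟨j, -, rfl⟩
      exact ⟨⟨_, rfl⟩, (h _).2 ⟨j, rfl⟩⟩
  rw [vertexSum, this, sum_image fun j _ j' _ hj => hg (hE hj)]
  exact sum_congr rfl fun j _ => hE.extend_apply _ _ _

open Finset in
/-- The edges of a regular bipartite graph are partitioned into perfect matchings. -/
theorem SimpleGraph.IsRegularOfDegree.exists_matchings {V : Type*} [Fintype V] [DecidableEq V]
    {G : SimpleGraph V} [DecidableRel G.Adj] {k : ℕ} (hk : 0 < k) (hreg : G.IsRegularOfDegree k)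
    (c : G.Coloring (Fin 2)) :
    ∃ π : Fin k → {v // c v = 0} ≃ {v // c v = 1},
      (∀ (a : {v // c v = 0}) (b : {v // c v = 1}), G.Adj a b ↔ ∃ j, π j a = b) ∧
        ∀ a, Function.Injective fun j => π j a := by
  let N : {v // c v = 0} → Finset {v // c v = 1} := fun a => {b | G.Adj a b}
  have hcol : ∀ {u v}, G.Adj u v → c u ≠ c v := fun h => c.valid h
  have hα : ∀ a, #(N a) = k := fun a => by
    rw [← hreg a, ← card_neighborFinset_eq_degree]
    refine card_bij (fun b _ => b.1) (fun b hb => by simpa [N] using hb)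
      (fun b _ b' _ h => Subtype.ext h) fun v hv => ?_
    rw [mem_neighborFinset] at hv
    have h1 := hcol hv
    rw [a.2] at h1
    exact ⟨⟨v, by omega⟩, by simpa [N] using hv, rfl⟩
  have hβ : ∀ b, #{a | b ∈ N a} = k := fun b => by
    rw [← hreg b, ← card_neighborFinset_eq_degree]
    refine card_bij (fun a _ => a.1) (fun a ha => by simpa [N, G.adj_comm] using ha)
      (fun a _ a' _ h => Subtype.ext h) fun v hv => ?_
    rw [mem_neighborFinset] at hv
    have h1 := hcol hv
    rw [b.2] at h1
    exact ⟨⟨v, by omega⟩, by simpa [N, G.adj_comm] using hv, rfl⟩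
  -- Count edges from both sides and cancel k.
  have hcard : Fintype.card {v // c v = 0} = Fintype.card {v // c v = 1} := by
    refine Nat.eq_of_mul_eq_mul_right hk
      (card_mul_eq_card_mul (s := univ) (t := univ) (fun a b => b ∈ N a) (fun a _ => ?_)
        fun b _ => ?_)
    · simpa [bipartiteAbove] using hα a
    · simpa [bipartiteBelow] using hβ b
  obtain ⟨π, hπ, hinj⟩ := exists_equivs_of_biregular k N hα hβ hcard
  exact ⟨π, fun a b => by rw [← hπ]; simp [N], hinj⟩

theorem mainTheorem2 {V : Type*} [Fintype V] [DecidableEq V] (G : SimpleGraph V)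
    [DecidableRel G.Adj] (k : ℕ) (hk : 8 ≤ k) (hk_even : Even k)
    (hbip : G.IsBipartite) (hreg : G.IsRegularOfDegree k) :
    G.IsAntimagic := by
  obtain ⟨c⟩ := hbip
  obtain ⟨m, rfl⟩ : ∃ m, k = (m + 4) * 2 := by
    obtain ⟨r, rfl⟩ := hk_even
    exact ⟨r - 4, by omega⟩
  obtain ⟨π₀, hπ₀, hinj₀⟩ := hreg.exists_matchings (by omega) c
  let e : Fin (m + 4) × Bool ≃ Fin ((m + 4) * 2) := Fintype.equivFinOfCardEq (by simp)
  let π : Fin (m + 4) × Bool → {v // c v = 0} ≃ {v // c v = 1} := fun j => π₀ (e j)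
  have hπ : ∀ (a : {v // c v = 0}) (b : {v // c v = 1}), G.Adj a b ↔ ∃ j, π j a = b := fun a b => by
    rw [hπ₀]
    exact e.surjective.exists
  have hinj : ∀ a, Function.Injective fun j => π j a := fun a => (hinj₀ a).comp e.injective
  obtain ⟨f, hf, hfI, hA, hB, hAB⟩ := exists_matching_labeling m π hinj
  let E : {v // c v = 0} × (Fin (m + 4) × Bool) → Sym2 V := fun p => s(p.1.1, (π p.2 p.1).1)
  have hne : ∀ (a : {v // c v = 0}) (b : {v // c v = 1}), a.1 ≠ b.1 := fun a b h => by
    have := a.2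
    rw [h, b.2] at this
    exact absurd this (by decide)
  have hmemA : ∀ (a : {v // c v = 0}) p, a.1 ∈ E p ↔ p.1 = a := fun a p => by
    simp only [E, Sym2.mem_iff, hne, or_false, Subtype.ext_iff, eq_comm]
  have hmemB : ∀ (b : {v // c v = 1}) p, b.1 ∈ E p ↔ π p.2 p.1 = b := fun b p => by
    simp only [E, Sym2.mem_iff, (hne _ _).symm, false_or, Subtype.ext_iff, eq_comm]
  have hE : Function.Injective E := by
    rintro ⟨a, j⟩ ⟨a', j'⟩ h
    have h1 := (hmemA a (a, j)).2 rfl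
    rw [h, hmemA] at h1
    obtain rfl : a' = a := h1
    have h2 := (hmemB (π j a') (a', j)).2 rfl
    rw [h, hmemB] at h2
    obtain rfl : j' = j := hinj a' h2
    rfl
  have hr : Set.range E = G.edgeSet := by
    ext x
    constructor
    · rintro ⟨p, rfl⟩
      exact (hπ _ _).2 ⟨p.2, rfl⟩
    · induction x using Sym2.ind with | _ u v
      intro huv
      rw [SimpleGraph.mem_edgeSet] at huv
      have hc := c.valid huv
      have h01 : (c u = 0 ∧ c v = 1) ∨ (c u = 1 ∧ c v = 0) := by omega
      rcases h01 with ⟨hu, hv⟩ | ⟨hu, hv⟩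
      · obtain ⟨j, hj⟩ := (hπ ⟨u, hu⟩ ⟨v, hv⟩).1 huv
        exact ⟨(⟨u, hu⟩, j), by simp only [E, hj]⟩
      · obtain ⟨j, hj⟩ := (hπ ⟨v, hv⟩ ⟨u, hu⟩).1 huv.symm
        exact ⟨(⟨v, hv⟩, j), by simp only [E, hj]; exact Sym2.eq_swap⟩
  let F := Function.extend E (fun p => f p.1 p.2) 0
  have hFE : ∀ p, F (E p) = f p.1 p.2 := fun p => hE.extend_apply _ _ _
  have hcard : G.edgeFinset.card = (m + 4) * (2 * Fintype.card {v // c v = 0}) := by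
    have : G.edgeFinset = Finset.univ.image E := by
      ext x
      rw [SimpleGraph.mem_edgeFinset, ← hr]
      simp
    rw [this, Finset.card_image_of_injective _ hE, Finset.card_univ, Fintype.card_prod,
      Fintype.card_prod, Fintype.card_fin, Fintype.card_bool]
    ring
  have hsA : ∀ a : {v // c v = 0}, G.vertexSum F a = ∑ j, f a j := fun a =>
    G.vertexSum_extend hE hr (fun p => f p.1 p.2) a (fun j => (a, j))
      (fun j j' h => (Prod.ext_iff.1 h).2) fun p => by
        rw [hmemA]
        exact ⟨fun h => ⟨p.2, by rw [← h]⟩, fun ⟨j, h⟩ => by rw [← h]⟩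
  have hsB : ∀ b : {v // c v = 1}, G.vertexSum F b = ∑ j, f ((π j).symm b) j := fun b =>
    G.vertexSum_extend hE hr (fun p => f p.1 p.2) b (fun j => ((π j).symm b, j))
      (fun j j' h => (Prod.ext_iff.1 h).2) fun p => by
        rw [hmemB]
        exact ⟨fun h => ⟨p.2, by rw [← h, Equiv.symm_apply_apply]⟩,
          fun ⟨j, h⟩ => by rw [← h, Equiv.apply_symm_apply]⟩
  refine ⟨F, ?_, fun u v huv h => huv ?_⟩
  · have himg : Finset.univ.image (fun p : {v // c v = 0} × (Fin (m + 4) × Bool) => f p.1 p.2)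
        = Finset.Icc 1 G.edgeFinset.card := by
      -- Injective labels within an interval of the same size fill it.
      refine Finset.eq_of_subset_of_card_le (fun x hx => ?_) ?_
      · obtain ⟨p, -, rfl⟩ := Finset.mem_image.1 hx
        rw [hcard]
        exact hfI p.1 p.2
      · rw [Finset.card_image_of_injective _ hf, Nat.card_Icc, Nat.add_sub_cancel, hcard,
          Finset.card_univ, Fintype.card_prod, Fintype.card_prod, Fintype.card_fin,
          Fintype.card_bool]
        exact le_of_eq (by ring)
    rw [SimpleGraph.IsEdgeLabeling, ← hr, ← Finset.coe_Icc, ← himg, Finset.coe_image,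
      Finset.coe_univ, Set.image_univ, Set.BijOn]
    refine ⟨?_, ?_, ?_⟩
    · rintro _ ⟨p, rfl⟩
      exact ⟨p, (hFE p).symm⟩
    · rintro _ ⟨p, rfl⟩ _ ⟨p', rfl⟩ h
      rw [hFE, hFE] at h
      rw [hf h]
    · rintro _ ⟨p, rfl⟩
      exact ⟨E p, ⟨p, rfl⟩, hFE p⟩
  · have h01 : ∀ w, c w = 0 ∨ c w = 1 := fun w => by omega
    rcases h01 u with hu | hu <;> rcases h01 v with hv | hv
    · rw [hsA ⟨u, hu⟩, hsA ⟨v, hv⟩] at h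
      exact congrArg Subtype.val (hA h)
    · rw [hsA ⟨u, hu⟩, hsB ⟨v, hv⟩] at h
      exact absurd h (hAB _ _)
    · rw [hsB ⟨u, hu⟩, hsA ⟨v, hv⟩] at h
      exact absurd h.symm (hAB _ _)
    · rw [hsB ⟨u, hu⟩, hsB ⟨v, hv⟩] at h
      exact congrArg Subtype.val (hB h)
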